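/- Let $B$ be a Hermitian $n\times n$ matrix ($n\ge 1$) with eigenvalues $b_1\le b_2\le\dots\le b_n$, listed with multiplicity. Let $g$ be a real function that is concave on the interval $[b_1,b_n]$ and differentiable at each $b_j$, as a function on $[b_1,b_n]$ (so the derivatives at the endpoints $b_1$ and $b_n$ are one-sided), and suppose that $g'(b_1)=1$ and $g'(b_n)=0$. Let $K$ be the Loewner matrix of $g$ at $B$, that is, the $n\times n$ matrix with entries $$K_{ij}=\begin{cases}\dfrac{g(b_i)-g(b_j)}{b_i-b_j}, & b_i\ne b_j,\\[2mm] g'(b_i), & b_i=b_j.\end{cases}$$ For the Schur multiplier $S_K:A\mapsto K\circ A$ (entrywise product) on complex $n\times n$ matrices, put $$\|S_K\|_1=\sup_{A\ne0}\frac{\|K\circ A\|_1}{\|A\|_1},\qquad \|S_K\|=\sup_{A\ne0}\frac{\|K\circ A\|}{\|A\|},$$ where $\|A\|_1=\operatorname{Tr}\,(A^*A)^{1/2}$ is the trace norm and $\|A\|$ is the operator norm. Then $$\|S_K\|_1=\|S_K\|\le 1+\phi^{-1}\sum_{j=1}^n\bigl(1-g'(b_j)\bigr),$$ where $\phi=(1+\sqrt5)/2$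 is the golden ratio. -/

import Mathlib

open scoped Matrix

noncomputable section

/-- The Loewner matrix of `g` at the real points `b 1, …, b n` of a set `I` (an interval) on which
`g` is considered: divided differences `(g (b i) - g (b j)) / (b i - b j)` where `b i ≠ b j`, and
the derivative `g' (b i)` where `b i = b j`.  The derivative is the one of `g` as a function on `I`,
so on a closed interval it is the ordinary derivative at interior points and the one-sided
derivative at the endpoints. -/
def loewnerMatrix (I : Set ℝ) (g : ℝ → ℝ) {n : ℕ} (b : Fin n → ℝ) :
    Matrix (Fin n) (Fin n) ℂ :=
  Matrix.of fun i j =>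
    (((if b i = b j then derivWithin g I (b i) else (g (b i) - g (b j)) / (b i - b j)) : ℝ) : ℂ)

/-- The trace norm (Schatten `1`-norm) of a square complex matrix: the trace of `(A* A)^(1/2)`. -/
def matrixTraceNorm {n : ℕ} (A : Matrix (Fin n) (Fin n) ℂ) : ℝ :=
  (Matrix.trace (cfc Real.sqrt (Aᴴ * A))).re

/-- The operator norm of a square complex matrix with respect to the Euclidean norm. -/
def matrixOpNorm {n : ℕ} (A : Matrix (Fin n) (Fin n) ℂ) : ℝ :=
  ‖Matrix.toEuclideanCLM (n := Fin n) (𝕜 := ℂ) A‖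

/-- The norm of the Schur multiplier `A ↦ L ∘ A` (entrywise product) induced by the norm `N` on
matrices: the supremum of `N (L ∘ A) / N A` over `A ≠ 0`, taken in the extended reals. -/
def schurMultiplierNorm {n : ℕ} (N : Matrix (Fin n) (Fin n) ℂ → ℝ)
    (L : Matrix (Fin n) (Fin n) ℂ) : EReal :=
  ⨆ (A : Matrix (Fin n) (Fin n) ℂ) (_ : A ≠ 0), ((N (L ⊙ A) / N A : ℝ) : EReal)

end

/-! Concavity puts each chord slope `K i j` (`i ≤ j`) between the derivatives `d j ≤ d i`, where `d`
decreases from 1 to 0. Only this, and the symmetry of `K`, is used.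

Layer-cake: `d` is a convex combination, with weights `d k - d (k+1)`, of indicators of initial
segments `S`. Interpolating entrywise, `K` is the same convex combination of symmetric-pattern
matrices equal to 1 on `S × S`, 0 on `Sᶜ × Sᶜ`, and with entries in `[0, 1]` elsewhere. Such a block
has multiplier norm at most `1 + φ⁻¹ |Sᶜ|` (`matrixOpNorm_block_le`), and the weighted mean of
`|Sᶜ|` is `∑ (1 - d j)`.

The two multiplier norms agree because the trace norm and the operator norm are dual under `tr (X
A)`, and a symmetric multiplier is its own adjoint for this pairing. -/

/-! ### Operator norm through sesquilinear forms -/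

open scoped Matrix.Norms.L2Operator in
theorem matrixOpNorm_eq {n : ℕ} (A : Matrix (Fin n) (Fin n) ℂ) : matrixOpNorm A = ‖A‖ :=
  (Matrix.l2_opNorm_toEuclideanCLM A).symm

theorem inner_toEuclideanCLM_eq_sum {n : ℕ} (A : Matrix (Fin n) (Fin n) ℂ)
    (u v : EuclideanSpace ℂ (Fin n)) :
    inner ℂ u (Matrix.toEuclideanCLM (n := Fin n) (𝕜 := ℂ) A v) =
      ∑ i, ∑ j, star (u i) * A i j * v j := by
  simp only [PiLp.inner_apply, Matrix.ofLp_toEuclideanCLM, Matrix.mulVec, dotProduct,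
    RCLike.inner_apply, Finset.sum_mul]
  refine Finset.sum_congr rfl fun i _ => Finset.sum_congr rfl fun j _ => ?_
  rw [starRingEnd_apply]
  ring

/-- Cauchy–Schwarz followed by weighted AM-GM; the free weight `t` is what later brings in the
golden ratio. -/
theorem norm_sum_mul_le {n : ℕ} (A : Matrix (Fin n) (Fin n) ℂ) (u v : Fin n → ℂ) {t : ℝ}
    (ht : 0 < t) :
    ‖∑ i, ∑ j, star (u i) * A i j * v j‖ ≤
      matrixOpNorm A * ((t * ∑ i, ‖u i‖ ^ 2 + t⁻¹ * ∑ j, ‖v j‖ ^ 2) / 2) := by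
  have h := inner_toEuclideanCLM_eq_sum A (WithLp.toLp 2 u) (WithLp.toLp 2 v)
  simp only at h
  rw [← h]
  have hu := EuclideanSpace.norm_sq_eq (WithLp.toLp 2 u : EuclideanSpace ℂ (Fin n))
  have hv := EuclideanSpace.norm_sq_eq (WithLp.toLp 2 v : EuclideanSpace ℂ (Fin n))
  simp only at hu hv
  rw [← hu, ← hv]
  set x := (WithLp.toLp 2 u : EuclideanSpace ℂ (Fin n))
  set y := (WithLp.toLp 2 v : EuclideanSpace ℂ (Fin n))
  have h1 : ‖x‖ * ‖y‖ ≤ (t * ‖x‖ ^ 2 + t⁻¹ * ‖y‖ ^ 2) / 2 := by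
    have h2 : t * ‖x‖ ^ 2 + t⁻¹ * ‖y‖ ^ 2 - 2 * (‖x‖ * ‖y‖) = t⁻¹ * (t * ‖x‖ - ‖y‖) ^ 2 := by
      field_simp
      ring
    have h3 : 0 ≤ t⁻¹ * (t * ‖x‖ - ‖y‖) ^ 2 := by positivity
    linarith
  calc _ ≤ ‖x‖ * ‖Matrix.toEuclideanCLM (n := Fin n) (𝕜 := ℂ) A y‖ := norm_inner_le_norm _ _
    _ ≤ ‖x‖ * (matrixOpNorm A * ‖y‖) := by
        gcongr
        exact ContinuousLinearMap.le_opNorm _ _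
    _ = matrixOpNorm A * (‖x‖ * ‖y‖) := by ring
    _ ≤ _ := by
        gcongr
        exact norm_nonneg _

theorem matrixOpNorm_le_of_norm_sum_le {n : ℕ} (A : Matrix (Fin n) (Fin n) ℂ) {C : ℝ}
    (hC : 0 ≤ C)
    (h : ∀ u v : Fin n → ℂ, ‖∑ i, ∑ j, star (u i) * A i j * v j‖ ≤
      C * ((∑ i, ‖u i‖ ^ 2 + ∑ j, ‖v j‖ ^ 2) / 2)) : matrixOpNorm A ≤ C := by
  refine ContinuousLinearMap.opNorm_le_bound _ hC fun v => ?_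
  set w := Matrix.toEuclideanCLM (n := Fin n) (𝕜 := ℂ) A v with hw
  by_cases hw0 : w = 0
  · rw [hw0, norm_zero]
    positivity
  have hv0 : v ≠ 0 := by
    rintro rfl
    exact hw0 (by rw [hw, map_zero])
  have hwn : 0 < ‖w‖ := norm_pos_iff.2 hw0
  have hvn : 0 < ‖v‖ := norm_pos_iff.2 hv0
  -- Testing against the image of `v`, rescaled to the norm of `v`, loses nothing in AM-GM.
  set u : EuclideanSpace ℂ (Fin n) := ((‖v‖ / ‖w‖ : ℝ) : ℂ) • w with hu
  have hun : ‖u‖ = ‖v‖ := by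
    rw [hu, norm_smul, Complex.norm_real, Real.norm_of_nonneg (by positivity)]
    field_simp
  have h1 := h u v
  rw [← inner_toEuclideanCLM_eq_sum, ← hw, ← EuclideanSpace.norm_sq_eq,
    ← EuclideanSpace.norm_sq_eq, hun, hu, inner_smul_left, inner_self_eq_norm_sq_to_K, norm_mul,
    norm_pow] at h1
  simp only [RCLike.norm_conj, Complex.norm_real, norm_norm, Complex.coe_algebraMap] at h1
  rw [Real.norm_of_nonneg (by positivity)] at h1
  have h2 : ‖v‖ / ‖w‖ * ‖w‖ ^ 2 = ‖w‖ * ‖v‖ := by field_simp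
  have h3 : C * ((‖v‖ ^ 2 + ‖v‖ ^ 2) / 2) = (C * ‖v‖) * ‖v‖ := by ring
  rw [h2, h3] at h1
  exact le_of_mul_le_mul_right h1 hvn

/-! ### The bound for one block -/

/-- Entrywise multiplication by a matrix that is `1` on `S × S`, has entries in `[0, 1]` where
exactly one index is in `S`, and vanishes elsewhere. -/
theorem matrixOpNorm_block_le {n : ℕ} (A : Matrix (Fin n) (Fin n) ℂ) (S : Finset (Fin n))
    (hS : 0 < Sᶜ.card) (T : Fin n → Fin n → ℝ) (hT : ∀ i j, T i j ∈ Set.Icc (0 : ℝ) 1)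
    (N : Matrix (Fin n) (Fin n) ℂ)
    (h11 : ∀ i ∈ S, ∀ j ∈ S, N i j = 1) (h12 : ∀ i ∈ S, ∀ j ∈ Sᶜ, N i j = T i j)
    (h21 : ∀ i ∈ Sᶜ, ∀ j ∈ S, N i j = T i j) (h22 : ∀ i ∈ Sᶜ, ∀ j ∈ Sᶜ, N i j = 0) :
    matrixOpNorm (N ⊙ A) ≤ (1 + Real.goldenRatio⁻¹ * Sᶜ.card) * matrixOpNorm A := by
  have ha : 0 ≤ matrixOpNorm A := norm_nonneg _
  have hφ : 0 < Real.goldenRatio := Real.goldenRatio_pos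
  have hφ1 : Real.goldenRatio = 1 + Real.goldenRatio⁻¹ := by
    have := Real.inv_goldenRatio
    have := Real.goldenRatio_add_goldenConj
    linarith
  set φ := Real.goldenRatio
  set m : ℝ := (Sᶜ.card : ℝ) with hm
  have hm1 : (1 : ℝ) ≤ m := Nat.one_le_cast.2 hS
  set a := matrixOpNorm A
  have hC : 0 ≤ 1 + φ⁻¹ * m :=
    add_nonneg zero_le_one (mul_nonneg (inv_nonneg.2 hφ.le) (zero_le_one.trans hm1))
  refine matrixOpNorm_le_of_norm_sum_le _ (mul_nonneg hC ha) fun u v => ?_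
  have hsq : ∀ x : Fin n → ℂ, ∑ i, ‖if i ∈ S then x i else 0‖ ^ 2 = ∑ i ∈ S, ‖x i‖ ^ 2 := by
    intro x
    rw [← Finset.univ_inter S, ← Finset.sum_ite_mem]
    refine Finset.sum_congr rfl fun i _ => ?_
    rw [Finset.univ_inter]
    split_ifs <;> simp
  have hsqT : ∀ (x : Fin n → ℂ) (t : Fin n → ℝ), (∀ i, t i ∈ Set.Icc (0 : ℝ) 1) →
      ∑ i, ‖if i ∈ S then x i * t i else 0‖ ^ 2 ≤ ∑ i ∈ S, ‖x i‖ ^ 2 := by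
    intro x t ht
    rw [hsq]
    refine Finset.sum_le_sum fun i _ => ?_
    rw [norm_mul, Complex.norm_real, Real.norm_of_nonneg (ht i).1]
    have : ‖x i‖ * t i ≤ ‖x i‖ := mul_le_of_le_one_right (norm_nonneg _) (ht i).2
    have h0 : 0 ≤ ‖x i‖ * t i := mul_nonneg (norm_nonneg _) (ht i).1
    gcongr
  have hsingle : ∀ (j : Fin n) (c : ℂ), ∑ i, ‖if i = j then c else 0‖ ^ 2 = ‖c‖ ^ 2 := by
    intro j c
    rw [Finset.sum_eq_single j] <;> simp +contextual
  have hsplit : ∀ f : Fin n → ℂ, ∑ i, f i = ∑ i ∈ S, f i + ∑ i ∈ Sᶜ, f i := fun f =>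
    (Finset.sum_add_sum_compl S f).symm
  have hsplitR : ∀ f : Fin n → ℝ, ∑ i, f i = ∑ i ∈ S, f i + ∑ i ∈ Sᶜ, f i := fun f =>
    (Finset.sum_add_sum_compl S f).symm
  have hite : ∀ f : Fin n → ℂ, ∑ i ∈ S, f i = ∑ i, if i ∈ S then f i else 0 := by
    intro f
    rw [Finset.sum_ite_mem, Finset.univ_inter]
  set F := fun i j => star (u i) * (N ⊙ A) i j * v j with hF
  have e : ∑ i, ∑ j, F i j = ∑ i ∈ S, ∑ j ∈ S, F i j + ∑ j ∈ Sᶜ, ∑ i ∈ S, F i j +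
      ∑ i ∈ Sᶜ, ∑ j ∈ S, F i j := by
    rw [hsplit, Finset.sum_congr rfl (fun i _ => hsplit (F i)), Finset.sum_add_distrib,
      Finset.sum_comm (s := S) (t := Sᶜ)]
    congr 1
    refine Finset.sum_congr rfl fun i hi => ?_
    rw [hsplit, add_eq_left]
    refine Finset.sum_eq_zero fun j hj => ?_
    simp [hF, h22 i hi j hj]
  have b1 : ‖∑ i ∈ S, ∑ j ∈ S, F i j‖ ≤
      a * ((∑ i ∈ S, ‖u i‖ ^ 2 + ∑ i ∈ S, ‖v i‖ ^ 2) / 2) := by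
    have := norm_sum_mul_le A (fun i => if i ∈ S then u i else 0)
      (fun i => if i ∈ S then v i else 0) one_pos
    rw [hsq, hsq, inv_one, one_mul, one_mul] at this
    refine le_of_eq_of_le ?_ this
    congr 1
    rw [hite]
    refine Finset.sum_congr rfl fun i _ => ?_
    split_ifs with hi
    · rw [hite]
      refine Finset.sum_congr rfl fun j _ => ?_
      split_ifs with hj
      · simp [hF, h11 i hi j hj]
      · simp
    · simp
  -- A single column of `T` acts as a diagonal contraction and can be absorbed into `u`. The weight
  -- is `φ⁻¹` on the `S` side, which is charged once per column, and `φ` on the `Sᶜ` side, charged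
  -- once only.
  have b2 : ∀ j ∈ Sᶜ, ‖∑ i ∈ S, F i j‖ ≤
      a * ((φ⁻¹ * ∑ i ∈ S, ‖u i‖ ^ 2 + φ * ‖v j‖ ^ 2) / 2) := by
    intro j hj
    have := norm_sum_mul_le A (fun i => if i ∈ S then u i * T i j else 0)
      (fun i => if i = j then v j else 0) (inv_pos.2 hφ)
    rw [hsingle, inv_inv] at this
    refine le_trans (le_of_eq_of_le ?_ this) ?_
    · congr 1
      rw [hite]
      refine Finset.sum_congr rfl fun i _ => ?_
      split_ifs with hi
      · simp only [hF, Matrix.hadamard_apply, h12 i hi j hj, mul_ite, mul_zero,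
          Finset.sum_ite_eq', Finset.mem_univ, if_true, star_mul', Complex.star_def,
          Complex.conj_ofReal]
        ring
      · simp
    · gcongr
      exact hsqT u (fun i => T i j) fun i => hT i j
  have b3 : ∀ i ∈ Sᶜ, ‖∑ j ∈ S, F i j‖ ≤
      a * ((φ⁻¹ * ∑ j ∈ S, ‖v j‖ ^ 2 + φ * ‖u i‖ ^ 2) / 2) := by
    intro i hi
    have := norm_sum_mul_le A (fun k => if k = i then u i else 0)
      (fun j => if j ∈ S then v j * T i j else 0) hφ
    rw [hsingle] at this
    refine le_trans (le_of_eq_of_le ?_ this) ?_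
    · congr 1
      rw [hite, eq_comm, Finset.sum_eq_single i]
      · rw [if_pos rfl]
        refine Finset.sum_congr rfl fun j _ => ?_
        split_ifs with hj
        · simp only [hF, Matrix.hadamard_apply, h21 i hi j hj]
          ring
        · simp
      · intro k _ hk
        simp [hk]
      · simp
    · rw [add_comm]
      gcongr
      exact hsqT v (fun j => T i j) fun j => hT i j
  have c2 : ‖∑ j ∈ Sᶜ, ∑ i ∈ S, F i j‖ ≤
      a * ((φ⁻¹ * m * ∑ i ∈ S, ‖u i‖ ^ 2 + φ * ∑ j ∈ Sᶜ, ‖v j‖ ^ 2) / 2) := by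
    refine (norm_sum_le_of_le _ b2).trans_eq ?_
    rw [← Finset.mul_sum, ← Finset.sum_div, Finset.sum_add_distrib, Finset.sum_const,
      nsmul_eq_mul, ← Finset.mul_sum]
    ring
  have c3 : ‖∑ i ∈ Sᶜ, ∑ j ∈ S, F i j‖ ≤
      a * ((φ⁻¹ * m * ∑ i ∈ S, ‖v i‖ ^ 2 + φ * ∑ j ∈ Sᶜ, ‖u j‖ ^ 2) / 2) := by
    refine (norm_sum_le_of_le _ b3).trans_eq ?_
    rw [← Finset.mul_sum, ← Finset.sum_div, Finset.sum_add_distrib, Finset.sum_const,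
      nsmul_eq_mul, ← Finset.mul_sum]
    ring
  -- The coefficients to compare are `1 + φ⁻¹ m` on `S` and `φ` on `Sᶜ`. They coincide at `m = 1`
  -- since `φ = 1 + φ⁻¹`, so `m ≥ 1` suffices.
  have hφC : φ ≤ 1 + φ⁻¹ * m := by
    have : φ⁻¹ * 1 ≤ φ⁻¹ * m := by gcongr
    linarith
  rw [e, hsplitR, hsplitR (fun j => ‖v j‖ ^ 2)]
  refine (norm_add₃_le.trans (add_le_add (add_le_add b1 c2) c3)).trans ?_
  set p := ∑ i ∈ S, ‖u i‖ ^ 2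
  set q := ∑ i ∈ S, ‖v i‖ ^ 2
  have hr : 0 ≤ ∑ i ∈ Sᶜ, ‖u i‖ ^ 2 := Finset.sum_nonneg fun _ _ => by positivity
  have hs : 0 ≤ ∑ i ∈ Sᶜ, ‖v i‖ ^ 2 := Finset.sum_nonneg fun _ _ => by positivity
  set r := ∑ i ∈ Sᶜ, ‖u i‖ ^ 2
  set s := ∑ i ∈ Sᶜ, ‖v i‖ ^ 2
  have h1 : φ * (r + s) ≤ (1 + φ⁻¹ * m) * (r + s) := by gcongr
  calc _ = a * (((1 + φ⁻¹ * m) * (p + q) + φ * (r + s)) / 2) := by ring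
    _ ≤ a * (((1 + φ⁻¹ * m) * (p + q) + (1 + φ⁻¹ * m) * (r + s)) / 2) := by gcongr
    _ = _ := by ring

/-! ### Duality of trace norm and operator norm -/

theorem matrixTraceNorm_eq_sum_sqrt {n : ℕ} (A : Matrix (Fin n) (Fin n) ℂ) :
    matrixTraceNorm A =
      ∑ i, Real.sqrt ((Matrix.isHermitian_conjTranspose_mul_self A).eigenvalues i) := by
  set hH := Matrix.isHermitian_conjTranspose_mul_self A
  unfold matrixTraceNorm
  rw [hH.cfc_eq, Matrix.IsHermitian.cfc, Unitary.conjStarAlgAut_apply, Matrix.trace_mul_comm,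
    ← mul_assoc, Unitary.coe_star_mul_self, one_mul, Matrix.trace_diagonal]
  simp

theorem matrixTraceNorm_nonneg {n : ℕ} (A : Matrix (Fin n) (Fin n) ℂ) : 0 ≤ matrixTraceNorm A := by
  rw [matrixTraceNorm_eq_sum_sqrt]
  exact Finset.sum_nonneg fun _ _ => Real.sqrt_nonneg _

theorem trace_eq_sum_inner_orthonormalBasis {n : ℕ} (M : Matrix (Fin n) (Fin n) ℂ)
    (e : OrthonormalBasis (Fin n) ℂ (EuclideanSpace ℂ (Fin n))) :
    M.trace = ∑ i, inner ℂ (e i) (Matrix.toEuclideanCLM (n := Fin n) (𝕜 := ℂ) M (e i)) := by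
  have h := LinearMap.trace_eq_sum_inner (Matrix.toEuclideanLin M) e
  rw [← Matrix.coe_toEuclideanCLM_eq_toEuclideanLin] at h
  have h2 : LinearMap.trace ℂ _ (Matrix.toEuclideanLin M) = M.trace := by
    rw [Matrix.toEuclideanLin_eq_toLin_orthonormal]
    exact Matrix.trace_toLin_eq _ _
  rw [← Matrix.coe_toEuclideanCLM_eq_toEuclideanLin] at h2
  rw [← h2, h]
  rfl

-- Compute the trace in an orthonormal eigenbasis `e i` of `Aᴴ * A`: there `‖A (e i)‖` is the square
-- root of the `i`-th eigenvalue.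
open scoped ComplexOrder in
theorem norm_trace_mul_le {n : ℕ} (X A : Matrix (Fin n) (Fin n) ℂ) :
    ‖(X * A).trace‖ ≤ matrixOpNorm X * matrixTraceNorm A := by
  set hH := Matrix.isHermitian_conjTranspose_mul_self A
  rw [matrixTraceNorm_eq_sum_sqrt, trace_eq_sum_inner_orthonormalBasis _ hH.eigenvectorBasis,
    Finset.mul_sum]
  refine norm_sum_le_of_le _ fun i _ => ?_
  set e := hH.eigenvectorBasis i with he
  have hen : ‖e‖ = 1 := hH.eigenvectorBasis.orthonormal.1 i
  have hAe : ‖Matrix.toEuclideanCLM (n := Fin n) (𝕜 := ℂ) A e‖ = Real.sqrt (hH.eigenvalues i) := by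
    symm
    rw [Real.sqrt_eq_iff_mul_self_eq ?_ (norm_nonneg _), ← sq, eq_comm]
    · have h1 : Matrix.toEuclideanCLM (n := Fin n) (𝕜 := ℂ) (Aᴴ * A) e =
          (hH.eigenvalues i : ℂ) • e := by
        ext j
        have := congrFun (hH.mulVec_eigenvectorBasis i) j
        simpa [Matrix.ofLp_toEuclideanCLM] using this
      have h2 : inner ℂ e (Matrix.toEuclideanCLM (n := Fin n) (𝕜 := ℂ) (Aᴴ * A) e) =
          ((‖Matrix.toEuclideanCLM (n := Fin n) (𝕜 := ℂ) A e‖ ^ 2 : ℝ) : ℂ) := by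
        rw [map_mul, mul_apply_eq_comp, ← Matrix.star_eq_conjTranspose, map_star,
          ContinuousLinearMap.star_eq_adjoint, ContinuousLinearMap.adjoint_inner_right,
          inner_self_eq_norm_sq_to_K]
        norm_cast
      rw [h1, inner_smul_right, inner_self_eq_norm_sq_to_K, hen] at h2
      simp only [map_one, one_pow, mul_one] at h2
      exact_mod_cast h2.symm
    · exact (Matrix.posSemidef_conjTranspose_mul_self A).eigenvalues_nonneg i
  calc _ ≤ ‖e‖ * ‖Matrix.toEuclideanCLM (n := Fin n) (𝕜 := ℂ) (X * A) e‖ := norm_inner_le_norm _ _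
    _ = ‖Matrix.toEuclideanCLM (n := Fin n) (𝕜 := ℂ) X
          (Matrix.toEuclideanCLM (n := Fin n) (𝕜 := ℂ) A e)‖ := by
        rw [hen, one_mul, map_mul]
        rfl
    _ ≤ _ := by
        rw [← hAe]
        exact ContinuousLinearMap.le_opNorm _ _

-- The adjoint of the partial isometry in the polar decomposition attains the duality: `X = G Aᴴ`
-- with `G` the pseudo-inverse of `√(Aᴴ A)`. Then `X A = √(Aᴴ A)`, and `X Xᴴ` is a projection.
open scoped Matrix.Norms.L2Operator ComplexOrder in
theorem exists_re_trace_mul_eq_matrixTraceNorm {n : ℕ} (A : Matrix (Fin n) (Fin n) ℂ) :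
    ∃ X : Matrix (Fin n) (Fin n) ℂ, matrixOpNorm X ≤ 1 ∧
      (X * A).trace.re = matrixTraceNorm A := by
  have hH : IsSelfAdjoint (Aᴴ * A) := Matrix.isHermitian_conjTranspose_mul_self A
  have hpos : ∀ x ∈ spectrum ℝ (Aᴴ * A), 0 ≤ x := by
    intro x hx
    rw [(Matrix.isHermitian_conjTranspose_mul_self A).spectrum_real_eq_range_eigenvalues] at hx
    obtain ⟨i, rfl⟩ := hx
    exact (Matrix.posSemidef_conjTranspose_mul_self A).eigenvalues_nonneg i
  have hcont : ∀ f : ℝ → ℝ, ContinuousOn f (spectrum ℝ (Aᴴ * A)) := fun f =>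
    (Matrix.finite_real_spectrum (A := Aᴴ * A)).continuousOn f
  set H := Aᴴ * A with hHdef
  -- The convention `0⁻¹ = 0` makes this the pseudo-inverse on the kernel.
  set G := cfc (fun x : ℝ => (Real.sqrt x)⁻¹) H with hG
  have hGstar : Gᴴ = G := (cfc_predicate (fun x : ℝ => (Real.sqrt x)⁻¹) H : IsSelfAdjoint G)
  have hGH : G * H = cfc Real.sqrt H := by
    nth_rewrite 1 [← cfc_id' ℝ H hH]
    rw [hG, ← cfc_mul _ _ _ (hcont _) (hcont _)]
    refine cfc_congr fun x hx => ?_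
    rw [inv_mul_eq_div, Real.div_sqrt]
  set P := G * H * G with hP
  have hPc : P = cfc (fun x : ℝ => Real.sqrt x * (Real.sqrt x)⁻¹) H := by
    rw [hP, hGH, hG, ← cfc_mul _ _ _ (hcont _) (hcont _)]
  have hPstar : star P = P := by
    rw [hPc]
    exact (cfc_predicate (fun x : ℝ => Real.sqrt x * (Real.sqrt x)⁻¹) H : IsSelfAdjoint _)
  have hPP : P * P = P := by
    rw [hPc, ← cfc_mul _ _ _ (hcont _) (hcont _)]
    refine cfc_congr fun x hx => ?_
    by_cases h : Real.sqrt x = 0 <;> simp [h]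
  have hPn : ‖P‖ ≤ 1 := by
    have h1 : ‖P‖ * ‖P‖ = ‖P‖ := by
      rw [← Matrix.l2_opNorm_conjTranspose_mul_self, ← Matrix.star_eq_conjTranspose, hPstar, hPP]
    by_contra! h
    nlinarith
  refine ⟨G * Aᴴ, ?_, ?_⟩
  · rw [matrixOpNorm_eq]
    have h1 : ‖G * Aᴴ‖ * ‖G * Aᴴ‖ = ‖P‖ := by
      rw [← Matrix.l2_opNorm_conjTranspose (G * Aᴴ), ← Matrix.l2_opNorm_conjTranspose_mul_self,
        Matrix.conjTranspose_conjTranspose, Matrix.conjTranspose_mul,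
        Matrix.conjTranspose_conjTranspose, hGstar, hP, hHdef]
      simp only [mul_assoc]
    by_contra! h
    nlinarith
  · rw [mul_assoc, ← hHdef, hGH, matrixTraceNorm]

open scoped ComplexOrder in
theorem matrixTraceNorm_pos {n : ℕ} {A : Matrix (Fin n) (Fin n) ℂ} (hA : A ≠ 0) :
    0 < matrixTraceNorm A := by
  refine lt_of_le_of_ne (matrixTraceNorm_nonneg A) fun h => hA ?_
  have := norm_trace_mul_le Aᴴ A
  rw [← h, mul_zero] at this
  exact Matrix.trace_conjTranspose_mul_self_eq_zero_iff.1 (norm_le_zero_iff.1 this)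

theorem matrixOpNorm_pos {n : ℕ} {A : Matrix (Fin n) (Fin n) ℂ} (hA : A ≠ 0) :
    0 < matrixOpNorm A := by
  refine norm_pos_iff.2 fun h => hA ?_
  exact (map_eq_zero_iff _ (Matrix.toEuclideanCLM (n := Fin n) (𝕜 := ℂ)).injective).1 h

theorem trace_mul_hadamard {n : ℕ} (L X A : Matrix (Fin n) (Fin n) ℂ) (hL : Lᵀ = L) :
    (X * (L ⊙ A)).trace = ((L ⊙ X) * A).trace := by
  simp only [Matrix.trace, Matrix.diag, Matrix.mul_apply, Matrix.hadamard_apply]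
  refine Finset.sum_congr rfl fun i _ => Finset.sum_congr rfl fun j _ => ?_
  rw [← congrFun (congrFun hL i) j, Matrix.transpose_apply]
  ring

theorem matrixTraceNorm_hadamard_le {n : ℕ} {L : Matrix (Fin n) (Fin n) ℂ} (hL : Lᵀ = L) {C : ℝ}
    (hC : 0 ≤ C) (h : ∀ A, matrixOpNorm (L ⊙ A) ≤ C * matrixOpNorm A)
    (A : Matrix (Fin n) (Fin n) ℂ) : matrixTraceNorm (L ⊙ A) ≤ C * matrixTraceNorm A := by
  obtain ⟨X, hX, hXA⟩ := exists_re_trace_mul_eq_matrixTraceNorm (L ⊙ A)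
  rw [← hXA, trace_mul_hadamard L X A hL]
  refine (Complex.re_le_norm _).trans ((norm_trace_mul_le _ _).trans ?_)
  gcongr
  · exact matrixTraceNorm_nonneg A
  · exact (h X).trans (mul_le_of_le_one_right hC hX)

theorem matrixTraceNorm_vecMulVec_le {n : ℕ} (u v : Fin n → ℂ) :
    matrixTraceNorm (Matrix.vecMulVec v (star u)) ≤ (∑ i, ‖u i‖ ^ 2 + ∑ j, ‖v j‖ ^ 2) / 2 := by
  obtain ⟨X, hX, hXA⟩ := exists_re_trace_mul_eq_matrixTraceNorm (Matrix.vecMulVec v (star u))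
  have h := norm_sum_mul_le X u v one_pos
  rw [inv_one, one_mul, one_mul] at h
  have h0 : 0 ≤ (∑ i, ‖u i‖ ^ 2 + ∑ j, ‖v j‖ ^ 2) / 2 := by positivity
  have h1 : (X * Matrix.vecMulVec v (star u)).trace = ∑ i, ∑ j, star (u i) * X i j * v j := by
    simp only [Matrix.trace, Matrix.diag, Matrix.mul_apply, Matrix.vecMulVec_apply, Pi.star_apply]
    refine Finset.sum_congr rfl fun i _ => Finset.sum_congr rfl fun j _ => ?_
    ring
  rw [← hXA, h1]
  exact (Complex.re_le_norm _).trans (h.trans (mul_le_of_le_one_left h0 hX))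

/-- The converse transfer needs only rank-one test matrices, since these recover every value of the
form of `L ⊙ A`. -/
theorem matrixOpNorm_hadamard_le {n : ℕ} {L : Matrix (Fin n) (Fin n) ℂ} (hL : Lᵀ = L) {C : ℝ}
    (hC : 0 ≤ C) (h : ∀ A, matrixTraceNorm (L ⊙ A) ≤ C * matrixTraceNorm A)
    (A : Matrix (Fin n) (Fin n) ℂ) : matrixOpNorm (L ⊙ A) ≤ C * matrixOpNorm A := by
  have ha : 0 ≤ matrixOpNorm A := norm_nonneg _
  refine matrixOpNorm_le_of_norm_sum_le _ (by positivity) fun u v => ?_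
  have h1 : ((L ⊙ A) * Matrix.vecMulVec v (star u)).trace =
      ∑ i, ∑ j, star (u i) * (L ⊙ A) i j * v j := by
    simp only [Matrix.trace, Matrix.diag, Matrix.mul_apply, Matrix.vecMulVec_apply, Pi.star_apply]
    refine Finset.sum_congr rfl fun i _ => Finset.sum_congr rfl fun j _ => ?_
    ring
  rw [← h1, ← trace_mul_hadamard L _ _ hL]
  calc _ ≤ matrixOpNorm A * matrixTraceNorm (L ⊙ Matrix.vecMulVec v (star u)) :=
        norm_trace_mul_le _ _
    _ ≤ matrixOpNorm A * (C * ((∑ i, ‖u i‖ ^ 2 + ∑ j, ‖v j‖ ^ 2) / 2)) := by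
        gcongr
        refine (h _).trans ?_
        gcongr
        exact matrixTraceNorm_vecMulVec_le u v
    _ = _ := by ring

/-! ### Equality of the two multiplier norms -/

theorem schurMultiplierNorm_le_iff {n : ℕ} {N : Matrix (Fin n) (Fin n) ℂ → ℝ}
    (hN0 : N 0 = 0) (hN : ∀ A, A ≠ 0 → 0 < N A) (L : Matrix (Fin n) (Fin n) ℂ) (C : ℝ) :
    schurMultiplierNorm N L ≤ (C : EReal) ↔ ∀ A, N (L ⊙ A) ≤ C * N A := by
  simp only [schurMultiplierNorm, iSup_le_iff, EReal.coe_le_coe_iff]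
  refine forall_congr' fun A => ?_
  by_cases hA : A = 0
  · simp [hA, hN0]
  · simp only [ne_eq, hA, not_false_eq_true, forall_true_left]
    rw [div_le_iff₀ (hN A hA)]

theorem schurMultiplierNorm_nonneg {n : ℕ} (hn : 0 < n) {N : Matrix (Fin n) (Fin n) ℂ → ℝ}
    (hN : ∀ A, 0 ≤ N A) (L : Matrix (Fin n) (Fin n) ℂ) : 0 ≤ schurMultiplierNorm N L := by
  have : Nonempty (Fin n) := ⟨⟨0, hn⟩⟩
  have h1 : (1 : Matrix (Fin n) (Fin n) ℂ) ≠ 0 := one_ne_zero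
  refine le_trans ?_ (le_iSup₂ (f := fun (A : Matrix (Fin n) (Fin n) ℂ) (_ : A ≠ 0) =>
    ((N (L ⊙ A) / N A : ℝ) : EReal)) 1 h1)
  exact_mod_cast div_nonneg (hN _) (hN _)

theorem schurMultiplierNorm_traceNorm_eq_opNorm {n : ℕ} (hn : 0 < n)
    {L : Matrix (Fin n) (Fin n) ℂ} (hL : Lᵀ = L) :
    schurMultiplierNorm matrixTraceNorm L = schurMultiplierNorm matrixOpNorm L := by
  have t0 : matrixTraceNorm (0 : Matrix (Fin n) (Fin n) ℂ) = 0 := by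
    have h := matrixTraceNorm_vecMulVec_le (0 : Fin n → ℂ) 0
    refine le_antisymm ?_ (matrixTraceNorm_nonneg _)
    simpa using h
  have o0 : matrixOpNorm (0 : Matrix (Fin n) (Fin n) ℂ) = 0 := by simp [matrixOpNorm]
  have ht := schurMultiplierNorm_le_iff t0 (fun A => matrixTraceNorm_pos) L
  have ho := schurMultiplierNorm_le_iff o0 (fun A => matrixOpNorm_pos) L
  refine le_antisymm ?_ ?_
  -- It suffices to compare real upper bounds, which avoids treating an infinite supremum
  -- separately.
  · refine EReal.le_of_forall_lt_iff_le.1 fun z hz => ?_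
    have hz0 : 0 ≤ z := by
      exact_mod_cast (schurMultiplierNorm_nonneg hn (fun A => norm_nonneg _) L).trans hz.le
    exact (ht z).2 (matrixTraceNorm_hadamard_le hL hz0 ((ho z).1 hz.le))
  · refine EReal.le_of_forall_lt_iff_le.1 fun z hz => ?_
    have hz0 : 0 ≤ z := by
      exact_mod_cast (schurMultiplierNorm_nonneg hn matrixTraceNorm_nonneg L).trans hz.le
    exact (ho z).2 (matrixOpNorm_hadamard_le hL hz0 ((ht z).1 hz.le))

/-! ### Layer-cake decomposition -/

theorem sum_range_sub_mul_indicator {D : ℕ → ℝ} {i m : ℕ} (him : i ≤ m) :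
    ∑ k ∈ Finset.range m, (D k - D (k + 1)) * (if i ≤ k then 1 else 0) = D i - D m := by
  induction m, him using Nat.le_induction with
  | base =>
    rw [sub_self]
    refine Finset.sum_eq_zero fun k hk => ?_
    rw [if_neg (not_le.2 (Finset.mem_range.1 hk)), mul_zero]
  | succ m hm ih =>
    rw [Finset.sum_range_succ, ih, if_pos hm]
    ring

open scoped Matrix.Norms.L2Operator in
theorem matrixOpNorm_hadamard_le_of_antitone {n : ℕ} (hn : 0 < n) {d : Fin n → ℝ} (hd : Antitone d)
    (hd0 : d ⟨0, hn⟩ = 1) (hd1 : d ⟨n - 1, Nat.sub_lt hn Nat.one_pos⟩ = 0)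
    {κ : Fin n → Fin n → ℝ} (hsymm : ∀ i j, κ i j = κ j i)
    (hκ : ∀ i j, i ≤ j → κ i j ∈ Set.Icc (d j) (d i)) (A : Matrix (Fin n) (Fin n) ℂ) :
    matrixOpNorm ((Matrix.of fun i j => (κ i j : ℂ)) ⊙ A) ≤
      (1 + Real.goldenRatio⁻¹ * ∑ j, (1 - d j)) * matrixOpNorm A := by
  -- The interpolation is written symmetrically in `i, j` and linearly in `d`, so for fixed `T` it
  -- passes through the layer decomposition of `d`.
  have hT : ∀ i j, ∃ t ∈ Set.Icc (0 : ℝ) 1,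
      κ i j = d (max i j) + t * (d i + d j - 2 * d (max i j)) := by
    have key : ∀ i j, i ≤ j → ∃ t ∈ Set.Icc (0 : ℝ) 1, κ i j = d j + t * (d i - d j) := by
      intro i j hij
      have h := hκ i j hij
      rw [← segment_eq_Icc (h.1.trans h.2), segment_eq_image'] at h
      obtain ⟨t, ht, he⟩ := h
      exact ⟨t, ht, he.symm⟩
    intro i j
    rcases le_total i j with hij | hij
    · obtain ⟨t, ht, he⟩ := key i j hij
      exact ⟨t, ht, by rw [he, max_eq_right hij]; ring⟩
    · obtain ⟨t, ht, he⟩ := key j i hij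
      exact ⟨t, ht, by rw [hsymm, he, max_eq_left hij]; ring⟩
  choose T hT hκT using hT
  set D : ℕ → ℝ := fun k => if h : k < n then d ⟨k, h⟩ else 0 with hD
  have hDd : ∀ i : Fin n, D i = d i := fun i => by simp [hD]
  have hDl : D (n - 1) = 0 := by
    rw [← hd1, ← hDd]
  have hw : ∀ k ∈ Finset.range (n - 1), 0 ≤ D k - D (k + 1) := by
    intro k hk
    have hk' := Finset.mem_range.1 hk
    rw [hDd ⟨k, by omega⟩, hDd ⟨k + 1, by omega⟩, sub_nonneg]
    exact hd (by simp)
  -- Only cuts `k < n - 1` are used, so the last index always lies in `Sᶜ` and the block bound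
  -- applies.
  set E : ℕ → Fin n → ℝ := fun k i => if (i : ℕ) ≤ k then 1 else 0 with hE
  have hsumE : ∀ i, ∑ k ∈ Finset.range (n - 1), (D k - D (k + 1)) * E k i = d i := by
    intro i
    rw [hE, sum_range_sub_mul_indicator (by omega), hDl, hDd, sub_zero]
  have hsum1 : ∑ k ∈ Finset.range (n - 1), (D k - D (k + 1)) = 1 := by
    rw [← hd0, ← hsumE ⟨0, hn⟩]
    simp [hE]
  have hEE : ∀ k i j, E k i * E k j = E k (max i j) := by
    intro k i j
    rcases le_total i j with hij | hij
    · rw [max_eq_right hij]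
      have : (i : ℕ) ≤ j := hij
      simp only [hE]
      split_ifs <;> first | omega | simp
    · rw [max_eq_left hij]
      have : (j : ℕ) ≤ i := hij
      simp only [hE]
      split_ifs <;> first | omega | simp
  set N : ℕ → Matrix (Fin n) (Fin n) ℂ := fun k => Matrix.of fun i j =>
    ((E k i * E k j + T i j * (E k i + E k j - 2 * (E k i * E k j)) : ℝ) : ℂ) with hN
  have hdecomp : (Matrix.of fun i j => (κ i j : ℂ)) ⊙ A =
      ∑ k ∈ Finset.range (n - 1), ((D k - D (k + 1) : ℝ) : ℂ) • (N k ⊙ A) := by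
    ext i j
    simp only [Matrix.sum_apply, Matrix.smul_apply, Matrix.hadamard_apply, smul_eq_mul, ← mul_assoc]
    rw [← Finset.sum_mul, Matrix.of_apply]
    congr 1
    simp only [hN, Matrix.of_apply, ← Complex.ofReal_mul, ← Complex.ofReal_sum]
    congr 1
    rw [hκT i j, ← hsumE (max i j), ← hsumE i, ← hsumE j]
    simp only [← hEE, Finset.mul_sum, ← Finset.sum_add_distrib, ← Finset.sum_sub_distrib]
    refine Finset.sum_congr rfl fun k _ => ?_
    ring
  have hblock : ∀ k ∈ Finset.range (n - 1), matrixOpNorm (N k ⊙ A) ≤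
      (1 + Real.goldenRatio⁻¹ * ∑ j, (1 - E k j)) * matrixOpNorm A := by
    intro k hk
    have hk' := Finset.mem_range.1 hk
    set S : Finset (Fin n) := Finset.univ.filter fun i => (i : ℕ) ≤ k with hS
    have hE1 : ∀ i ∈ S, E k i = 1 := fun i hi => if_pos (by simpa [hS] using hi)
    have hE0 : ∀ i ∈ Sᶜ, E k i = 0 := fun i hi => if_neg (by simpa [hS] using hi)
    have hcard : ∑ j, (1 - E k j) = (Sᶜ.card : ℝ) := by
      rw [← Finset.sum_add_sum_compl S, Finset.sum_eq_zero (fun i hi => by rw [hE1 i hi, sub_self]),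
        Finset.sum_congr rfl (fun i hi => by rw [hE0 i hi, sub_zero]), zero_add]
      simp
    rw [hcard]
    refine matrixOpNorm_block_le A S ?_ T hT (N k) ?_ ?_ ?_ ?_
    · refine Finset.card_pos.2 ⟨⟨n - 1, by omega⟩, ?_⟩
      simp [hS]
      omega
    · intro i hi j hj
      simp only [hN, Matrix.of_apply, hE1 i hi, hE1 j hj]
      norm_num
    · intro i hi j hj
      simp [hN, hE1 i hi, hE0 j hj]
    · intro i hi j hj
      simp [hN, hE0 i hi, hE1 j hj]
    · intro i hi j hj
      simp [hN, hE0 i hi, hE0 j hj]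
  have htotal : ∑ k ∈ Finset.range (n - 1), (D k - D (k + 1)) *
      (1 + Real.goldenRatio⁻¹ * ∑ j, (1 - E k j)) =
      1 + Real.goldenRatio⁻¹ * ∑ j, (1 - d j) := by
    have h1 : ∀ j, 1 - d j = ∑ k ∈ Finset.range (n - 1), (D k - D (k + 1)) * (1 - E k j) := by
      intro j
      simp only [mul_sub, mul_one, Finset.sum_sub_distrib]
      rw [← Finset.sum_sub_distrib, hsum1, hsumE]
    simp only [h1, mul_add, mul_one, Finset.sum_add_distrib, hsum1]
    rw [Finset.sum_comm, Finset.mul_sum]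
    congr 1
    refine Finset.sum_congr rfl fun k _ => ?_
    rw [← Finset.mul_sum]
    ring
  rw [hdecomp, matrixOpNorm_eq, ← htotal, Finset.sum_mul]
  refine norm_sum_le_of_le _ fun k hk => ?_
  rw [norm_smul, Complex.norm_real, Real.norm_of_nonneg (hw k hk), ← matrixOpNorm_eq, mul_assoc]
  exact mul_le_mul_of_nonneg_left (hblock k hk) (hw k hk)

/-! ### Loewner matrices of concave functions -/

theorem mainTheorem2 (n : ℕ) (hn : 0 < n)
    (B : Matrix (Fin n) (Fin n) ℂ) (hB : B.IsHermitian)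
    (b : Fin n → ℝ) (hb_mono : Monotone b)
    (hb_eig : ∃ σ : Equiv.Perm (Fin n), ∀ j, b j = hB.eigenvalues (σ j))
    (I : Set ℝ) (hI : I = Set.Icc (b ⟨0, hn⟩) (b ⟨n - 1, Nat.sub_lt hn Nat.one_pos⟩))
    (g : ℝ → ℝ) (hg : ConcaveOn ℝ I g)
    (hg_diff : ∀ j, DifferentiableWithinAt ℝ g I (b j))
    (hg_first : derivWithin g I (b ⟨0, hn⟩) = 1)
    (hg_last : derivWithin g I (b ⟨n - 1, Nat.sub_lt hn Nat.one_pos⟩) = 0) :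
    schurMultiplierNorm matrixTraceNorm (loewnerMatrix I g b) =
        schurMultiplierNorm matrixOpNorm (loewnerMatrix I g b) ∧
      schurMultiplierNorm matrixOpNorm (loewnerMatrix I g b) ≤
        ((1 + Real.goldenRatio⁻¹ * ∑ j, (1 - derivWithin g I (b j)) : ℝ) : EReal) := by
  have hbI : ∀ j, b j ∈ I := by
    intro j
    rw [hI]
    exact ⟨hb_mono (Fin.mk_le_of_le_val (Nat.zero_le _)), hb_mono (Fin.le_def.2 (by simp; omega))⟩
  set κ : Fin n → Fin n → ℝ := fun i j =>
    if b i = b j then derivWithin g I (b i) else (g (b i) - g (b j)) / (b i - b j) with hκdef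
  have hK : loewnerMatrix I g b = Matrix.of fun i j => (κ i j : ℂ) := rfl
  have hsymm : ∀ i j, κ i j = κ j i := by
    intro i j
    simp only [hκdef]
    by_cases h : b i = b j
    · rw [if_pos h, if_pos h.symm, h]
    · rw [if_neg h, if_neg (Ne.symm h), ← neg_sub (g (b j)), ← neg_sub (b j), neg_div_neg_eq]
  have hκ : ∀ i j, i ≤ j → κ i j ∈ Set.Icc (derivWithin g I (b j)) (derivWithin g I (b i)) := by
    intro i j hij
    simp only [hκdef]
    by_cases h : b i = b j
    · rw [if_pos h, h]
      exact ⟨le_rfl, le_rfl⟩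
    · have hlt : b i < b j := lt_of_le_of_ne (hb_mono hij) h
      rw [if_neg h, ← neg_sub (g (b j)), ← neg_sub (b j), neg_div_neg_eq, ← slope_def_field]
      exact ⟨hg.derivWithin_le_slope (hbI i) (hbI j) hlt (hg_diff j),
        hg.slope_le_derivWithin (hbI i) (hbI j) hlt (hg_diff i)⟩
  have hd : Antitone fun j => derivWithin g I (b j) := fun i j hij =>
    (hκ i j hij).1.trans (hκ i j hij).2
  refine ⟨schurMultiplierNorm_traceNorm_eq_opNorm hn ?_, ?_⟩
  · rw [hK]
    ext i j
    simp [hsymm i j]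
  · rw [schurMultiplierNorm_le_iff (by simp [matrixOpNorm]) (fun A => matrixOpNorm_pos), hK]
    exact matrixOpNorm_hadamard_le_of_antitone hn hd hg_first hg_last hsymm hκ
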